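/- **Setup.** For positive integers $n,k,t$ with $kt\le n$, a *planting* is an ordered $t$-tuple $S=(S_1,\dots,S_t)$ of pairwise disjoint $k$-subsets of $[n]$. Let $\mathcal D_0$ be the uniform distribution on $\{0,1\}^n$, let $p=kt/n$, and let $$\mathsf D_S=(1-p)\,\mathcal D_0+\frac pt\sum_{i=1}^t \mathcal D_0(\,\cdot\mid x_v=1\ \ \forall v\in S_i).$$ A $\mathrm{VSTAT}(N)$ oracle ($N>0$) for a distribution $D$ on a set $X$ answers each query $f:X\to[0,1]$ by a real $v$ with $|v-\mathbb E_D f|\le\max\{1/N,\sqrt{\mathrm{Var}_D(f)/N}\}$. A randomized SQ algorithm draws a random seed and then makes adaptively chosen queries to the oracle before it outputs one bit. It distinguishes an unknown $\mathsf D_S$ from $\mathcal D_0$ with success probability at least $2/3$ if, with probability at least $2/3$, it outputs "null" for every valid oracle for $\mathcal D_0$, and "planted" for every planting $S$ and every valid oracle for $\mathsf D_S$. **Theorem (SQ lower bound).** There are absolute constants $c,C>0$ such that the following holds. (1) Let $\delta>0$ be fixed and let $k=k(n)\ge1$, $t=t(n)\ge1$ be integers with $kt=O(n^{1/2-\delta})$.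 Let $\ell=\ell(n)$ be integers with $0\le\ell\le\min\{kt,\lfloor\log_2(n/(k^2t^2))\rfloor-1\}$, $\ell=O(\log n)$ and $\ell^2=o(kt)$. Put $$d=\Big\lfloor \ell!\,\Big(\frac{n}{k^2t^2}\Big)^{\ell}\Big\rfloor,\qquad \bar\gamma=2\,\frac{k^2}{n^2}\,2^{\ell}.$$ Then, for all sufficiently large $n$, any randomized SQ algorithm that distinguishes an unknown $\mathsf D_S$ from $\mathcal D_0$ with success probability at least $2/3$ using queries to $\mathrm{VSTAT}(N)$, where $N=C/\bar\gamma$ (or, more generally, $0<N\le C/\bar\gamma$), must make at least $c\,d$ queries: if it makes at most $q$ queries for all these input distributions, valid oracles and seeds, then $q\ge c\,d$. (2) In particular, if $k,t\ge 1$, $kt=O(n^{1/2-\delta})$ for a fixed $\delta>0$ and $kt=\omega((\log n)^2)$, then $\ell=\lfloor\delta\log_2 n\rfloor$ satisfies (for all sufficiently large $n$) the conditions in (1), and for this choice $d\ge\exp(a(\ln n)^2)$ for all sufficiently large $n$, where $a>0$ depends only on $\delta$, and $N=C/\bar\gamma=\Theta(n^{2-\delta}/k^2)$. -/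

import Mathlib

open MeasureTheory ProbabilityTheory Filter Asymptotics

universe u

namespace MultiBiclique

/-- A planting: an ordered `t`-tuple of pairwise disjoint `k`-subsets of `[n]`. -/
abbrev Planting (n k t : ℕ) : Type :=
  {S : Fin t → Finset (Fin n) //
    (∀ i, (S i).card = k) ∧ ∀ i j, i ≠ j → Disjoint (S i) (S j)}

/-- The null distribution: uniform on `{0,1}^n`. -/
noncomputable def nullDist (n : ℕ) : Measure (Fin n → Bool) :=
  (PMF.uniformOfFintype (Fin n → Bool)).toMeasure

/-- The null distribution conditioned on `x_v = 1` for all `v ∈ B`. -/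
noncomputable def condDist {n : ℕ} (B : Finset (Fin n)) : Measure (Fin n → Bool) :=
  ProbabilityTheory.cond (nullDist n) {x | ∀ v ∈ B, x v = true}

/-- The planted distribution `(1 - p) D₀ + (p / t) ∑ᵢ D₀(· | x_v = 1 ∀ v ∈ Sᵢ)`, `p = kt/n`.
(The existence of a planting forces `kt ≤ n`, hence `p ≤ 1`.) -/
noncomputable def plantedDist {n k t : ℕ} (S : Planting n k t) : Measure (Fin n → Bool) :=
  ENNReal.ofReal (1 - (k * t : ℝ) / n) • nullDist n +
    ENNReal.ofReal (((k * t : ℝ) / n) / t) • ∑ i, condDist (S.1 i)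

/-- A statistical query over the domain `X`: a function `X → [0,1]`. -/
abbrev Query (X : Type) : Type := X → unitInterval

/-- An answering rule for statistical queries. -/
abbrev Oracle (X : Type) : Type := Query X → ℝ

/-- `O` is a valid `VSTAT(N)` oracle for the distribution `D`. -/
def IsVSTAT {X : Type} [MeasurableSpace X] (D : Measure X) (N : ℝ) (O : Oracle X) : Prop :=
  ∀ f : Query X, |O f - ∫ x, (f x : ℝ) ∂D| ≤
    max (1 / N) (Real.sqrt (variance (fun x => (f x : ℝ)) D / N))

/-- A deterministic adaptive SQ algorithm with one output bit: either it stops with an output, or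
it makes a query and continues in a way that depends on the (real) answer. -/
inductive SQTree (X : Type) : Type
  | halt (b : Bool) : SQTree X
  | ask (f : Query X) (next : ℝ → SQTree X) : SQTree X

/-- The output of the algorithm when its queries are answered by `O`. -/
def SQTree.output {X : Type} (O : Oracle X) : SQTree X → Bool
  | .halt b => b
  | .ask f next => (next (O f)).output O

/-- The number of queries the algorithm makes when they are answered by `O`. -/
def SQTree.numQueries {X : Type} (O : Oracle X) : SQTree X → ℕ
  | .halt _ => 0
  | .ask f next => (next (O f)).numQueries O + 1

/-- A randomized SQ algorithm: a deterministic one chosen by a random seed, such that the output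
is a random variable whatever oracle is used. -/
structure RandSQAlg (X : Type) : Type (u + 1) where
  Seed : Type u
  [mSeed : MeasurableSpace Seed]
  law : Measure Seed
  [isProb : IsProbabilityMeasure law]
  tree : Seed → SQTree X
  measurableSet_output : ∀ O : Oracle X, MeasurableSet {ω | (tree ω).output O = true}

/-- The probability that the algorithm outputs `b` when its queries are answered by `O`. -/
noncomputable def RandSQAlg.prob {X : Type} (A : RandSQAlg X) (O : Oracle X) (b : Bool) : ℝ :=
  letI := A.mSeed
  A.law.real {ω | (A.tree ω).output O = b}

/-- With `VSTAT(N)` access to the unknown distribution, `A` distinguishes every planted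
distribution (output `true`) from the null (output `false`) with success probability at least
`2/3`, whatever valid answers the oracle gives. -/
def Distinguishes (n k t : ℕ) (N : ℝ) (A : RandSQAlg (Fin n → Bool)) : Prop :=
  (∀ O, IsVSTAT (nullDist n) N O → 2 / 3 ≤ A.prob O false) ∧
  (∀ S : Planting n k t, ∀ O, IsVSTAT (plantedDist S) N O → 2 / 3 ≤ A.prob O true)

/-- `A` makes at most `q` queries on every input distribution of the problem, for all valid
`VSTAT(N)` oracles and all seeds. -/
def MakesAtMost (n k t : ℕ) (N : ℝ) (A : RandSQAlg (Fin n → Bool)) (q : ℕ) : Prop :=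
  (∀ O, IsVSTAT (nullDist n) N O → ∀ ω, (A.tree ω).numQueries O ≤ q) ∧
  (∀ S : Planting n k t, ∀ O, IsVSTAT (plantedDist S) N O →
    ∀ ω, (A.tree ω).numQueries O ≤ q)

/-- `d = ⌊ℓ! (n / (k²t²))^ℓ⌋`. -/
noncomputable def dimBound (n k t l : ℕ) : ℕ :=
  ⌊(l.factorial : ℝ) * ((n : ℝ) / ((k : ℝ) ^ 2 * (t : ℝ) ^ 2)) ^ l⌋₊

/-- `γ̄ = 2 (k²/n²) 2^ℓ`. -/
noncomputable def gammaBar (n k l : ℕ) : ℝ :=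
  2 * ((k : ℝ) ^ 2 / (n : ℝ) ^ 2) * 2 ^ l

/-- The parameter regime: `k, t ≥ 1` and `kt = O(n^{1/2-δ})`. -/
structure Regime (δ : ℝ) (k t : ℕ → ℕ) : Prop where
  pos : ∀ᶠ n in atTop, 0 < k n ∧ 0 < t n
  isBigO : (fun n => (k n * t n : ℝ)) =O[atTop] fun n : ℕ => (n : ℝ) ^ (1 / 2 - δ)

/-- The conditions on the overlap parameter `ℓ`: `0 ≤ ℓ ≤ min {kt, ⌊log₂ (n/(k²t²))⌋ - 1}`,
`ℓ = O(log n)` and `ℓ² = o(kt)`. -/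
structure OverlapParam (k t l : ℕ → ℕ) : Prop where
  le_min : ∀ᶠ n : ℕ in atTop, (l n : ℤ) ≤ min ((k n : ℤ) * t n)
    (⌊Real.logb 2 ((n : ℝ) / ((k n : ℝ) ^ 2 * (t n : ℝ) ^ 2))⌋ - 1)
  isBigO : (fun n => (l n : ℝ)) =O[atTop] fun n : ℕ => Real.log n
  isLittleO : (fun n => (l n : ℝ) ^ 2) =o[atTop] fun n => (k n * t n : ℝ)

end MultiBiclique

namespace MultiBiclique

/-- The set of all planted vertices. -/
def Planting.support {n k t : ℕ} (S : Planting n k t) : Finset (Fin n) :=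
  Finset.univ.biUnion S.1

theorem Planting.card_support {n k t : ℕ} (S : Planting n k t) : S.support.card = k * t := by
  unfold Planting.support
  rw [Finset.card_biUnion fun i _ j _ h => S.2.2 i j h]
  simp [S.2.1, mul_comm]

/-- Relabelling the vertices of a planting. -/
def Planting.map {n k t : ℕ} (e : Equiv.Perm (Fin n)) (S : Planting n k t) : Planting n k t :=
  ⟨fun i => (S.1 i).map e.toEmbedding, fun i => by simp [S.2.1],
    fun i j h => (Finset.disjoint_map _).2 (S.2.2 i j h)⟩

theorem Planting.map_injective {n k t : ℕ} (e : Equiv.Perm (Fin n)) :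
    Function.Injective (Planting.map (k := k) (t := t) e) := by
  intro S T h
  apply Subtype.ext
  funext i
  exact Finset.map_injective e.toEmbedding (congrFun (congrArg Subtype.val h) i)

theorem Planting.support_map {n k t : ℕ} (e : Equiv.Perm (Fin n)) (S : Planting n k t) :
    (S.map e).support = S.support.map e.toEmbedding := by
  ext x
  simp only [Planting.support, Planting.map, Finset.mem_biUnion, Finset.mem_map]
  constructor
  · rintro ⟨i, hi, y, hy, rfl⟩
    exact ⟨y, ⟨i, hi, hy⟩, rfl⟩
  · rintro ⟨y, ⟨i, hi, hy⟩, rfl⟩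
    exact ⟨i, hi, y, hy, rfl⟩

theorem exists_perm_map_eq {α : Type*} [Fintype α] [DecidableEq α] {s t : Finset α}
    (h : s.card = t.card) : ∃ e : Equiv.Perm α, s.map e.toEmbedding = t := by
  have e₀ : {x // x ∈ s} ≃ {x // x ∈ t} := Fintype.equivOfCardEq (by simpa using h)
  refine ⟨e₀.extendSubtype, Finset.eq_of_subset_of_card_le ?_ (by simp [h])⟩
  intro x hx
  obtain ⟨y, hy, rfl⟩ := Finset.mem_map.1 hx
  exact e₀.extendSubtype_mem y hy

theorem card_filter_subset_support_le {n k t : ℕ} {I J : Finset (Fin n)} (h : I.card = J.card) :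
    (Finset.univ.filter fun T : Planting n k t => I ⊆ T.support).card ≤
      (Finset.univ.filter fun T : Planting n k t => J ⊆ T.support).card := by
  obtain ⟨e, rfl⟩ := exists_perm_map_eq h
  refine Finset.card_le_card_of_injOn (Planting.map e) ?_ (Planting.map_injective e).injOn
  intro T hT
  simp only [Finset.coe_filter, Finset.mem_univ, true_and, Set.mem_ofPred_eq] at hT ⊢
  rw [Planting.support_map]
  exact Finset.map_subset_map.2 hT

theorem sum_choose_card_inter {n k t : ℕ} (U : Finset (Fin n)) (j : ℕ) :
    ∑ T : Planting n k t, (U ∩ T.support).card.choose j =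
      ∑ J ∈ U.powersetCard j,
        (Finset.univ.filter fun T : Planting n k t => J ⊆ T.support).card := by
  simp_rw [← Finset.card_powersetCard, Finset.card_filter]
  rw [Finset.sum_comm]
  refine Finset.sum_congr rfl fun T _ => ?_
  rw [← Finset.card_filter]
  congr 1
  ext J
  simp only [Finset.mem_powersetCard, Finset.mem_filter, Finset.subset_inter_iff]
  tauto

/-- The factorial moments of the overlap of a fixed set with a uniformly random planting. -/
theorem choose_mul_sum_choose_card_inter {n k t : ℕ} (U : Finset (Fin n)) (j : ℕ) :
    n.choose j * ∑ T : Planting n k t, (U ∩ T.support).card.choose j =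
      U.card.choose j * ((k * t).choose j * Fintype.card (Planting n k t)) := by
  have htot : ∑ J ∈ (Finset.univ : Finset (Fin n)).powersetCard j,
      (Finset.univ.filter fun T : Planting n k t => J ⊆ T.support).card =
        (k * t).choose j * Fintype.card (Planting n k t) := by
    rw [← sum_choose_card_inter]
    simp [Planting.card_support, mul_comm]
  rw [sum_choose_card_inter, ← htot]
  by_cases hU : (U.powersetCard j).Nonempty
  · obtain ⟨J, hJ⟩ := hU
    have hc : ∀ I : Finset (Fin n), I.card = j →
        (Finset.univ.filter fun T : Planting n k t => I ⊆ T.support).card =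
          (Finset.univ.filter fun T : Planting n k t => J ⊆ T.support).card := fun I hI =>
      have h := hI.trans (Finset.mem_powersetCard.1 hJ).2.symm
      le_antisymm (card_filter_subset_support_le h) (card_filter_subset_support_le h.symm)
    rw [Finset.sum_congr rfl fun I hI => hc I (Finset.mem_powersetCard.1 hI).2,
      Finset.sum_congr rfl fun I hI => hc I (Finset.mem_powersetCard.1 hI).2]
    simp
    ring
  · have h0 : U.card.choose j = 0 := by
      rw [← Finset.card_powersetCard, Finset.not_nonempty_iff_eq_empty.1 hU, Finset.card_empty]
    rw [Finset.not_nonempty_iff_eq_empty.1 hU, h0]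
    simp

theorem choose_mul_pow_le {m n : ℕ} (h : m ≤ n) (j : ℕ) :
    m.choose j * n ^ j ≤ n.choose j * m ^ j := by
  induction j with
  | zero => simp
  | succ j ih =>
    have hm := Nat.choose_succ_right_eq m j
    have hn := Nat.choose_succ_right_eq n j
    have hmn : (m - j) * n ≤ (n - j) * m := by
      rcases le_total j m with hj | hj
      · obtain ⟨a, rfl⟩ := Nat.exists_eq_add_of_le hj
        obtain ⟨b, rfl⟩ := Nat.exists_eq_add_of_le h
        rw [Nat.add_sub_cancel_left, show j + a + b - j = a + b by omega]
        nlinarith [Nat.zero_le (j * b)]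
      · simp [Nat.sub_eq_zero_of_le hj]
    refine Nat.le_of_mul_le_mul_right ?_ (Nat.succ_pos j)
    calc m.choose (j + 1) * n ^ (j + 1) * (j + 1)
        = (m.choose (j + 1) * (j + 1)) * n ^ (j + 1) := by ring
      _ = (m.choose j * n ^ j) * ((m - j) * n) := by rw [hm]; ring
      _ ≤ (n.choose j * m ^ j) * ((n - j) * m) := Nat.mul_le_mul ih hmn
      _ = (n.choose (j + 1) * (j + 1)) * m ^ (j + 1) := by rw [hn]; ring
      _ = n.choose (j + 1) * m ^ (j + 1) * (j + 1) := by ring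

theorem sum_choose_card_inter_le {n k t : ℕ} (hn : 0 < n) (hkt : k * t ≤ n) (U : Finset (Fin n))
    (hU : U.card = k * t) (j : ℕ) :
    (∑ T : Planting n k t, ((U ∩ T.support).card.choose j : ℝ)) ≤
      Fintype.card (Planting n k t) * (((k * t : ℕ) : ℝ) ^ 2 / n) ^ j / j.factorial := by
  have hn' : (0 : ℝ) < n := by exact_mod_cast hn
  rcases lt_or_ge n j with hj | hj
  · have : ∀ T : Planting n k t, ((U ∩ T.support).card.choose j : ℝ) = 0 := fun T => by
      rw [Nat.choose_eq_zero_of_lt, Nat.cast_zero]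
      exact lt_of_le_of_lt (by simpa using Finset.card_le_univ (U ∩ T.support)) hj
    rw [Finset.sum_eq_zero fun T _ => this T]
    positivity
  have hc : (0 : ℝ) < n.choose j := by exact_mod_cast Nat.choose_pos hj
  have h1 := choose_mul_sum_choose_card_inter (k := k) (t := t) U j
  rw [hU] at h1
  have h2 : (n.choose j : ℝ) * ∑ T : Planting n k t, ((U ∩ T.support).card.choose j : ℝ) =
      (k * t).choose j * ((k * t).choose j * Fintype.card (Planting n k t)) := by
    exact_mod_cast h1
  have h3 : ((k * t).choose j : ℝ) * n ^ j ≤ n.choose j * ((k * t : ℕ) : ℝ) ^ j := by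
    exact_mod_cast choose_mul_pow_le hkt j
  have h4 : ((k * t).choose j : ℝ) ≤ ((k * t : ℕ) : ℝ) ^ j / j.factorial :=
    Nat.choose_le_pow_div j (k * t)
  refine le_of_mul_le_mul_left ?_ hc
  rw [h2]
  have h5 : ((k * t).choose j : ℝ) ≤ n.choose j * (((k * t : ℕ) : ℝ) ^ j / n ^ j) := by
    rw [← mul_div_assoc, le_div_iff₀ (by positivity)]
    exact h3
  calc ((k * t).choose j : ℝ) * ((k * t).choose j * Fintype.card (Planting n k t))
      ≤ (n.choose j * (((k * t : ℕ) : ℝ) ^ j / n ^ j)) *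
        (((k * t : ℕ) : ℝ) ^ j / j.factorial * Fintype.card (Planting n k t)) := by gcongr
    _ = _ := by rw [div_pow]; field_simp; ring

theorem two_pow_le_sum_choose {L M l : ℕ} (h : L ≤ M) :
    2 ^ L ≤ 2 ^ l + 2 ^ l * ∑ i ∈ Finset.range M, L.choose (l + (i + 1)) := by
  rcases le_total L l with hl | hl
  · exact (Nat.pow_le_pow_right two_pos hl).trans (Nat.le_add_right _ _)
  obtain ⟨a, rfl⟩ := Nat.exists_eq_add_of_le hl
  rw [pow_add, show ∀ x, 2 ^ l + 2 ^ l * x = 2 ^ l * (1 + x) from fun x => by ring]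
  gcongr
  rw [← Nat.sum_range_choose, Finset.sum_range_succ', Nat.choose_zero_right, add_comm]
  gcongr 1 + ?_
  calc ∑ i ∈ Finset.range a, a.choose (i + 1)
      ≤ ∑ i ∈ Finset.range a, (l + a).choose (l + (i + 1)) := by
        refine Finset.sum_le_sum fun i _ => ?_
        rw [Nat.add_choose_eq]
        have := Finset.single_le_sum (f := fun ij : ℕ × ℕ => l.choose ij.1 * a.choose ij.2)
          (fun _ _ => Nat.zero_le _)
          (Finset.HasAntidiagonal.mem_antidiagonal.2 rfl :
            ((l, i + 1) : ℕ × ℕ) ∈ Finset.HasAntidiagonal.antidiagonal (l + (i + 1)))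
        simpa using this
    _ ≤ _ := Finset.sum_le_sum_of_subset (Finset.range_mono (by omega))

theorem sum_pow_div_factorial_le {r : ℝ} (h0 : 0 ≤ r) (h1 : r ≤ 1 / 2) (l M : ℕ) :
    ∑ i ∈ Finset.range M, r ^ (l + (i + 1)) / (l + (i + 1)).factorial ≤ r ^ l / l.factorial := by
  have hgeo : ∑ i ∈ Finset.range M, (1 / 2 : ℝ) ^ (i + 1) ≤ 1 := by
    have : ∑ i ∈ Finset.range M, (1 / 2 : ℝ) ^ (i + 1) = 1 - (1 / 2) ^ M := by
      induction M with
      | zero => simp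
      | succ M ih => rw [Finset.sum_range_succ, ih]; ring
    rw [this]
    have : (0 : ℝ) ≤ (1 / 2) ^ M := by positivity
    linarith
  calc ∑ i ∈ Finset.range M, r ^ (l + (i + 1)) / (l + (i + 1)).factorial
      ≤ ∑ i ∈ Finset.range M, r ^ l / l.factorial * (1 / 2) ^ (i + 1) := by
        refine Finset.sum_le_sum fun i _ => ?_
        rw [pow_add, div_mul_eq_mul_div]
        gcongr
        omega
    _ = r ^ l / l.factorial * ∑ i ∈ Finset.range M, (1 / 2 : ℝ) ^ (i + 1) := by
        rw [Finset.mul_sum]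
    _ ≤ r ^ l / l.factorial * 1 := by gcongr
    _ = _ := mul_one _

/-- On every large enough family of plantings the average of `2 ^ overlap` is at most `2 ^ (l+1)`. -/
theorem sum_two_pow_card_inter_le {n k t : ℕ} (hn : 0 < n) (hkt : k * t ≤ n)
    (hr : ((k * t : ℕ) : ℝ) ^ 2 / n ≤ 1 / 2) (U : Finset (Fin n)) (hU : U.card = k * t) (l : ℕ)
    (A : Finset (Planting n k t))
    (hA : Fintype.card (Planting n k t) * ((((k * t : ℕ) : ℝ) ^ 2 / n) ^ l / l.factorial) ≤
      A.card) :
    ∑ T ∈ A, (2 : ℝ) ^ (U ∩ T.support).card ≤ 2 * 2 ^ l * A.card := by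
  have hp : ∀ T : Planting n k t, (2 : ℝ) ^ (U ∩ T.support).card ≤
      2 ^ l + 2 ^ l * ∑ i ∈ Finset.range n, ((U ∩ T.support).card.choose (l + (i + 1)) : ℝ) :=
    fun T => by
      exact_mod_cast two_pow_le_sum_choose (l := l)
        (by simpa using Finset.card_le_univ (U ∩ T.support) : (U ∩ T.support).card ≤ n)
  calc ∑ T ∈ A, (2 : ℝ) ^ (U ∩ T.support).card
      ≤ ∑ T ∈ A, ((2 : ℝ) ^ l +
          2 ^ l * ∑ i ∈ Finset.range n, ((U ∩ T.support).card.choose (l + (i + 1)) : ℝ)) :=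
        Finset.sum_le_sum fun T _ => hp T
    _ = 2 ^ l * A.card + 2 ^ l * ∑ T ∈ A, ∑ i ∈ Finset.range n,
          ((U ∩ T.support).card.choose (l + (i + 1)) : ℝ) := by
        rw [Finset.sum_add_distrib, Finset.mul_sum]; simp [mul_comm]
    _ ≤ 2 ^ l * A.card + 2 ^ l * ∑ T : Planting n k t, ∑ i ∈ Finset.range n,
          ((U ∩ T.support).card.choose (l + (i + 1)) : ℝ) := by
        gcongr
        exact Finset.subset_univ A
    _ = 2 ^ l * A.card + 2 ^ l * ∑ i ∈ Finset.range n, ∑ T : Planting n k t,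
          ((U ∩ T.support).card.choose (l + (i + 1)) : ℝ) := by rw [Finset.sum_comm]
    _ ≤ 2 ^ l * A.card + 2 ^ l * ∑ i ∈ Finset.range n, Fintype.card (Planting n k t) *
          ((((k * t : ℕ) : ℝ) ^ 2 / n) ^ (l + (i + 1)) / (l + (i + 1)).factorial) := by
        gcongr with i
        rw [← mul_div_assoc]
        exact sum_choose_card_inter_le hn hkt U hU _
    _ ≤ 2 ^ l * A.card + 2 ^ l * (Fintype.card (Planting n k t) *
          ((((k * t : ℕ) : ℝ) ^ 2 / n) ^ l / l.factorial)) := by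
        rw [← Finset.mul_sum]
        gcongr
        exact sum_pow_div_factorial_le (by positivity) hr l n
    _ ≤ 2 ^ l * A.card + 2 ^ l * A.card := by gcongr
    _ = _ := by ring

instance isProbabilityMeasure_nullDist (n : ℕ) : IsProbabilityMeasure (nullDist n) := by
  unfold nullDist; infer_instance

/-- The event that all coordinates in `B` are `1`. -/
def allOnes {n : ℕ} (B : Finset (Fin n)) : Set (Fin n → Bool) := {x | ∀ v ∈ B, x v = true}

theorem measurableSet_allOnes {n : ℕ} (B : Finset (Fin n)) : MeasurableSet (allOnes B) :=
  (Set.toFinite _).measurableSet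

theorem card_allOnes {n : ℕ} (B : Finset (Fin n)) :
    (Finset.univ.filter fun x : Fin n → Bool => ∀ v ∈ B, x v = true).card = 2 ^ (n - B.card) := by
  have : (Finset.univ.filter fun x : Fin n → Bool => ∀ v ∈ B, x v = true) =
      Fintype.piFinset fun v => if v ∈ B then {true} else Finset.univ := by
    ext x
    simp only [Finset.mem_filter, Finset.mem_univ, true_and, Fintype.mem_piFinset]
    refine forall_congr' fun v => ?_
    by_cases h : v ∈ B <;> simp [h]
  rw [this, Fintype.card_piFinset]
  have h2 : ∀ v : Fin n, (if v ∈ B then ({true} : Finset Bool) else Finset.univ).card =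
      if v ∈ B then 1 else 2 := fun v => by by_cases h : v ∈ B <;> simp [h]
  simp_rw [h2]
  rw [Finset.prod_ite]
  simp only [Finset.prod_const_one, one_mul, Finset.prod_const]
  congr 1
  have := Finset.card_compl B
  rw [Fintype.card_fin] at this
  rw [← this]
  congr 1
  ext v
  simp

theorem nullDist_allOnes {n : ℕ} (B : Finset (Fin n)) :
    nullDist n (allOnes B) = ENNReal.ofReal ((1 / 2) ^ B.card) := by
  have hB : B.card ≤ n := by simpa using Finset.card_le_univ B
  classical
  have hc : Fintype.card (allOnes B) = 2 ^ (n - B.card) := by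
    rw [← card_allOnes B]
    exact (Fintype.card_subtype _).trans (by congr!)
  unfold nullDist
  rw [PMF.toMeasure_uniformOfFintype_apply _ (measurableSet_allOnes B), hc]
  obtain ⟨a, ha⟩ := Nat.exists_eq_add_of_le hB
  rw [← ENNReal.ofReal_natCast, ← ENNReal.ofReal_natCast, ← ENNReal.ofReal_div_of_pos]
  · congr 1
    simp only [Fintype.card_pi, Fintype.card_bool, Finset.prod_const, Finset.card_univ,
      Fintype.card_fin]
    have h2 : (2 : ℝ) ^ n = 2 ^ B.card * 2 ^ a := by rw [← pow_add, ← ha]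
    rw [show n - B.card = a by omega]
    push_cast
    rw [h2, one_div, inv_pow]
    field_simp
  · simp

/-- The indicator function of `allOnes B`. -/
noncomputable def onesInd {n : ℕ} (B : Finset (Fin n)) : (Fin n → Bool) → ℝ :=
  (allOnes B).indicator 1

theorem onesInd_mul {n : ℕ} (B B' : Finset (Fin n)) (x : Fin n → Bool) :
    onesInd B x * onesInd B' x = onesInd (B ∪ B') x := by
  have : allOnes (B ∪ B') = allOnes B ∩ allOnes B' := by
    ext x
    simp only [allOnes, Finset.mem_union, Set.mem_ofPred_eq, Set.mem_inter_iff]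
    exact ⟨fun h => ⟨fun v hv => h v (Or.inl hv), fun v hv => h v (Or.inr hv)⟩,
      fun h v hv => hv.elim (h.1 v) (h.2 v)⟩
  rw [onesInd, onesInd, onesInd, this, Set.inter_indicator_one]
  rfl

theorem integral_onesInd {n : ℕ} (B : Finset (Fin n)) :
    ∫ x, onesInd B x ∂nullDist n = (1 / 2) ^ B.card := by
  rw [onesInd, integral_indicator_one (measurableSet_allOnes B), Measure.real, nullDist_allOnes,
    ENNReal.toReal_ofReal (by positivity)]

theorem integral_condDist {n : ℕ} (B : Finset (Fin n)) (f : (Fin n → Bool) → ℝ) :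
    ∫ x, f x ∂condDist B = ∫ x, f x * (2 ^ B.card * onesInd B x) ∂nullDist n := by
  change ∫ x, f x ∂(nullDist n)[|allOnes B] = _
  rw [ProbabilityTheory.cond, integral_smul_measure, nullDist_allOnes,
    ← integral_indicator (measurableSet_allOnes B), ENNReal.toReal_inv,
    ENNReal.toReal_ofReal (by positivity), smul_eq_mul, ← integral_const_mul]
  congr 1
  funext x
  by_cases hx : x ∈ allOnes B
  · simp [onesInd, hx, mul_comm]
  · simp [onesInd, hx]

instance isFiniteMeasure_condDist {n : ℕ} (B : Finset (Fin n)) : IsFiniteMeasure (condDist B) := by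
  unfold condDist; infer_instance

/-- The density of `plantedDist S` with respect to `nullDist n`, minus `1`. -/
noncomputable def excess {n k t : ℕ} (S : Planting n k t) (x : Fin n → Bool) : ℝ :=
  (k / n : ℝ) * ∑ i, (2 ^ k * onesInd (S.1 i) x - 1)

theorem integral_plantedDist {n k t : ℕ} (ht : 0 < t) (hkt : k * t ≤ n) (S : Planting n k t)
    (f : (Fin n → Bool) → ℝ) :
    ∫ x, f x ∂plantedDist S =
      (1 - (k * t : ℝ) / n) * ∫ x, f x ∂nullDist n +
        (k / n : ℝ) * ∑ i, ∫ x, f x ∂condDist (S.1 i) := by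
  have hp : (k * t : ℝ) / n ≤ 1 := div_le_one_of_le₀ (by exact_mod_cast hkt) (by positivity)
  have ht' : (t : ℝ) ≠ 0 := by exact_mod_cast ht.ne'
  rw [plantedDist, integral_add_measure, integral_smul_measure, integral_smul_measure,
    integral_finsetSum_measure, ENNReal.toReal_ofReal (by linarith),
    ENNReal.toReal_ofReal (by positivity), smul_eq_mul, smul_eq_mul]
  · congr 2
    field_simp
  · exact fun i _ => Integrable.of_finite
  · exact Integrable.of_finite.smul_measure ENNReal.ofReal_ne_top
  · exact (integrable_finsetSum_measure.2 fun i _ => Integrable.of_finite).smul_measure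
      ENNReal.ofReal_ne_top

theorem integral_plantedDist_sub {n k t : ℕ} (ht : 0 < t) (hkt : k * t ≤ n) (S : Planting n k t)
    (f : (Fin n → Bool) → ℝ) :
    ∫ x, f x ∂plantedDist S - ∫ x, f x ∂nullDist n = ∫ x, f x * excess S x ∂nullDist n := by
  have h : ∀ i, ∫ x, f x * (2 ^ k * onesInd (S.1 i) x - 1) ∂nullDist n =
      ∫ x, f x ∂condDist (S.1 i) - ∫ x, f x ∂nullDist n := fun i => by
    rw [integral_condDist, S.2.1 i, ← integral_sub Integrable.of_finite Integrable.of_finite]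
    simp only [mul_sub, mul_one]
  simp only [excess, mul_left_comm (f _), Finset.mul_sum]
  rw [integral_finsetSum _ fun i _ => Integrable.of_finite]
  simp only [integral_const_mul, h]
  rw [integral_plantedDist ht hkt, ← Finset.mul_sum, Finset.sum_sub_distrib]
  simp only [Finset.sum_const, Finset.card_univ, Fintype.card_fin, nsmul_eq_mul]
  ring

theorem integral_excess {n k t : ℕ} (S : Planting n k t) :
    ∫ x, excess S x ∂nullDist n = 0 := by
  simp only [excess]
  rw [integral_const_mul, integral_finsetSum _ fun i _ => Integrable.of_finite]
  refine mul_eq_zero_of_right _ (Finset.sum_eq_zero fun i _ => ?_)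
  rw [integral_sub Integrable.of_finite Integrable.of_finite, integral_const_mul,
    integral_onesInd, S.2.1 i, ← mul_pow]
  simp

theorem integral_excess_mul_excess {n k t : ℕ} (S T : Planting n k t) :
    ∫ x, excess S x * excess T x ∂nullDist n =
      ((k : ℝ) ^ 2 / (n : ℝ) ^ 2) * ∑ i, ∑ j, ((2 : ℝ) ^ (S.1 i ∩ T.1 j).card - 1) := by
  have h : ∀ i j, ∫ x, (2 ^ k * onesInd (S.1 i) x - 1) * (2 ^ k * onesInd (T.1 j) x - 1)
      ∂nullDist n = (2 : ℝ) ^ (S.1 i ∩ T.1 j).card - 1 := fun i j => by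
    have hx : ∀ x, (2 ^ k * onesInd (S.1 i) x - 1) * (2 ^ k * onesInd (T.1 j) x - 1) =
        2 ^ k * 2 ^ k * onesInd (S.1 i ∪ T.1 j) x - (2 ^ k * onesInd (S.1 i) x +
          2 ^ k * onesInd (T.1 j) x - 1) := fun x => by
      rw [← onesInd_mul]; ring
    have hc := Finset.card_union_add_card_inter (S.1 i) (T.1 j)
    rw [S.2.1 i, T.2.1 j] at hc
    have h2 : (2 : ℝ) ^ k * (1 / 2) ^ k = 1 := by rw [← mul_pow]; simp
    have h3 : (2 : ℝ) ^ (S.1 i ∪ T.1 j).card * (1 / 2) ^ (S.1 i ∪ T.1 j).card = 1 := by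
      rw [← mul_pow]; simp
    simp_rw [hx]
    rw [integral_sub Integrable.of_finite Integrable.of_finite,
      integral_sub Integrable.of_finite Integrable.of_finite,
      integral_add Integrable.of_finite Integrable.of_finite, integral_const_mul,
      integral_const_mul, integral_const_mul, integral_onesInd, integral_onesInd,
      integral_onesInd, S.2.1 i, T.2.1 j, h2, ← pow_add, ← hc, pow_add,
      mul_right_comm, h3]
    simp
  have hx : ∀ x, excess S x * excess T x = ((k : ℝ) ^ 2 / (n : ℝ) ^ 2) *
      ∑ i, ∑ j, (2 ^ k * onesInd (S.1 i) x - 1) * (2 ^ k * onesInd (T.1 j) x - 1) := fun x => by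
    rw [← Finset.sum_mul_sum, excess, excess]; ring
  simp_rw [hx]
  rw [integral_const_mul, integral_finsetSum _ fun i _ => Integrable.of_finite]
  simp_rw [integral_finsetSum _ fun j _ => Integrable.of_finite, h]

theorem sum_two_pow_sub_one_le {ι : Type*} (s : Finset ι) (a : ι → ℕ) :
    ∑ i ∈ s, ((2 : ℝ) ^ a i - 1) ≤ 2 ^ (∑ i ∈ s, a i) - 1 := by
  classical
  induction s using Finset.induction_on with
  | empty => simp
  | insert i s hi ih =>
    rw [Finset.sum_insert hi, Finset.sum_insert hi, pow_add]
    have h1 : (1 : ℝ) ≤ 2 ^ a i := one_le_pow₀ one_le_two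
    have h2 : (1 : ℝ) ≤ 2 ^ ∑ i ∈ s, a i := one_le_pow₀ one_le_two
    nlinarith

theorem sum_sum_card_inter {n k t : ℕ} (S T : Planting n k t) :
    ∑ i, ∑ j, (S.1 i ∩ T.1 j).card = (S.support ∩ T.support).card := by
  have h : ∀ i, ∑ j, (S.1 i ∩ T.1 j).card = (S.1 i ∩ T.support).card := fun i => by
    rw [Planting.support, Finset.inter_biUnion, Finset.card_biUnion]
    exact fun a _ b _ hab => (T.2.2 a b hab).mono Finset.inter_subset_right
      Finset.inter_subset_right
  simp_rw [h]
  rw [show S.support = Finset.univ.biUnion S.1 from rfl, Finset.biUnion_inter,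
    Finset.card_biUnion]
  exact fun a _ b _ hab => (S.2.2 a b hab).mono Finset.inter_subset_left Finset.inter_subset_left

theorem integral_excess_mul_excess_le {n k t : ℕ} (S T : Planting n k t) :
    ∫ x, excess S x * excess T x ∂nullDist n ≤
      ((k : ℝ) ^ 2 / (n : ℝ) ^ 2) * 2 ^ (S.support ∩ T.support).card := by
  rw [integral_excess_mul_excess, ← sum_sum_card_inter, ← Finset.sum_product', ← Finset.sum_product']
  gcongr
  exact (sum_two_pow_sub_one_le _ _).trans (sub_le_self _ zero_le_one)

theorem variance_nullDist_le {n k t : ℕ} (ht : 0 < t) (hkt : k * t ≤ n) (S : Planting n k t)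
    (f : (Fin n → Bool) → ℝ) :
    (1 - (k * t : ℝ) / n) * variance f (nullDist n) ≤ variance f (plantedDist S) := by
  have hp : (k * t : ℝ) / n ≤ 1 := div_le_one_of_le₀ (by exact_mod_cast hkt) (by positivity)
  rw [variance_eq_integral (μ := plantedDist S) (Measurable.of_discrete.aemeasurable),
    integral_plantedDist ht hkt]
  set a := ∫ x, f x ∂plantedDist S
  have h0 : variance f (nullDist n) ≤ ∫ x, (f x - a) ^ 2 ∂nullDist n := by
    rw [← variance_sub_const Measurable.of_discrete.aestronglyMeasurable a]
    exact variance_le_expectation_sq Measurable.of_discrete.aestronglyMeasurable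
  have h1 : 0 ≤ (k / n : ℝ) * ∑ i, ∫ x, (f x - a) ^ 2 ∂condDist (S.1 i) :=
    mul_nonneg (by positivity) (Finset.sum_nonneg fun i _ => integral_nonneg fun x => sq_nonneg _)
  have h2 := mul_le_mul_of_nonneg_left h0 (sub_nonneg.2 hp)
  linarith

theorem sq_integral_mul_le {n : ℕ} (f g : (Fin n → Bool) → ℝ) :
    (∫ x, f x * g x ∂nullDist n) ^ 2 ≤
      (∫ x, f x ^ 2 ∂nullDist n) * ∫ x, g x ^ 2 ∂nullDist n := by
  simp only [integral_fintype Integrable.of_finite, smul_eq_mul]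
  refine Finset.sum_sq_le_sum_mul_sum_of_sq_le_mul _ (fun x _ => by positivity)
    (fun x _ => by positivity) fun x _ => le_of_eq (by ring)

/-- The value `∫ f dD₀` is not a valid `VSTAT(N)` answer to the query `f` for `D_S`. -/
def Detects {n k t : ℕ} (N : ℝ) (f : Query (Fin n → Bool)) (S : Planting n k t) : Prop :=
  max (1 / N) (Real.sqrt (variance (fun x => (f x : ℝ)) (plantedDist S) / N)) <
    |∫ x, (f x : ℝ) ∂nullDist n - ∫ x, (f x : ℝ) ∂plantedDist S|

theorem sq_sum_integral_mul_excess_le {n k t : ℕ} (f : (Fin n → Bool) → ℝ)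
    (A : Finset (Planting n k t)) :
    (∑ S ∈ A, ∫ x, f x * excess S x ∂nullDist n) ^ 2 ≤
      variance f (nullDist n) * ∑ S ∈ A, ∑ T ∈ A, ∫ x, excess S x * excess T x ∂nullDist n := by
  set a := ∫ x, f x ∂nullDist n with ha
  have h1 : ∑ S ∈ A, ∫ x, f x * excess S x ∂nullDist n =
      ∫ x, (f x - a) * ∑ S ∈ A, excess S x ∂nullDist n := by
    simp_rw [Finset.mul_sum]
    rw [integral_finsetSum _ fun i _ => Integrable.of_finite]
    refine Finset.sum_congr rfl fun S _ => ?_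
    simp_rw [sub_mul]
    rw [integral_sub Integrable.of_finite Integrable.of_finite, integral_const_mul,
      integral_excess, mul_zero, sub_zero]
  have h2 : ∑ S ∈ A, ∑ T ∈ A, ∫ x, excess S x * excess T x ∂nullDist n =
      ∫ x, (∑ S ∈ A, excess S x) ^ 2 ∂nullDist n := by
    simp_rw [sq, Finset.sum_mul_sum]
    rw [integral_finsetSum _ fun i _ => Integrable.of_finite]
    simp_rw [integral_finsetSum _ fun i _ => Integrable.of_finite]
  rw [h1, h2, variance_eq_integral Measurable.of_discrete.aemeasurable]
  exact sq_integral_mul_le _ _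

theorem sum_sum_integral_excess_le {n k t : ℕ} (hn : 0 < n) (hkt : k * t ≤ n)
    (hr : ((k * t : ℕ) : ℝ) ^ 2 / n ≤ 1 / 2) (l : ℕ) (A : Finset (Planting n k t))
    (hA : Fintype.card (Planting n k t) * ((((k * t : ℕ) : ℝ) ^ 2 / n) ^ l / l.factorial) ≤
      A.card) :
    ∑ S ∈ A, ∑ T ∈ A, ∫ x, excess S x * excess T x ∂nullDist n ≤
      gammaBar n k l * (A.card : ℝ) ^ 2 := by
  calc ∑ S ∈ A, ∑ T ∈ A, ∫ x, excess S x * excess T x ∂nullDist n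
      ≤ ∑ S ∈ A, ∑ T ∈ A, ((k : ℝ) ^ 2 / (n : ℝ) ^ 2) * 2 ^ (S.support ∩ T.support).card :=
        Finset.sum_le_sum fun S _ => Finset.sum_le_sum fun T _ =>
          integral_excess_mul_excess_le S T
    _ ≤ ∑ S ∈ A, ((k : ℝ) ^ 2 / (n : ℝ) ^ 2) * (2 * 2 ^ l * A.card) := by
        refine Finset.sum_le_sum fun S _ => ?_
        rw [← Finset.mul_sum]
        gcongr
        exact sum_two_pow_card_inter_le hn hkt hr _ S.card_support l A hA
    _ = _ := by
        rw [Finset.sum_const, nsmul_eq_mul, gammaBar]; ring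

/-- A family of plantings detected by one query with a constant sign of the deviation is small. -/
theorem card_lt_of_detects {n k t : ℕ} (hn : 0 < n) (hk : 0 < k) (ht : 0 < t)
    (hkt : 2 * (k * t) ≤ n)
    (hr : ((k * t : ℕ) : ℝ) ^ 2 / n ≤ 1 / 2) (l : ℕ) {N : ℝ} (hN : 0 < N)
    (hN' : N ≤ 1 / 2 / gammaBar n k l) (f : Query (Fin n → Bool)) (ε : ℝ) (hε : |ε| = 1)
    (A : Finset (Planting n k t)) (hA0 : A.Nonempty)
    (hA : ∀ S ∈ A, Detects N f S ∧ 0 ≤ ε * ∫ x, (f x : ℝ) * excess S x ∂nullDist n) :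
    (A.card : ℝ) <
      Fintype.card (Planting n k t) * ((((k * t : ℕ) : ℝ) ^ 2 / n) ^ l / l.factorial) := by
  by_contra! hcard
  have hkt' : k * t ≤ n := by omega
  have hγ : 0 < gammaBar n k l := by unfold gammaBar; positivity
  set V := variance (fun x => (f x : ℝ)) (nullDist n) with hV
  have hV0 : 0 ≤ V := variance_nonneg _ _
  have hp : (k * t : ℝ) / n ≤ 1 / 2 := by
    rw [div_le_div_iff₀ (by exact_mod_cast hn) two_pos]
    have : (2 * (k * t) : ℝ) ≤ n := by exact_mod_cast hkt
    linarith
  have hlow : ∀ S ∈ A, Real.sqrt (V * gammaBar n k l) <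
      ε * ∫ x, (f x : ℝ) * excess S x ∂nullDist n := by
    intro S hS
    obtain ⟨hdet, hsign⟩ := hA S hS
    rw [← abs_of_nonneg hsign, abs_mul, hε, one_mul,
      ← integral_plantedDist_sub ht hkt' S (fun x => (f x : ℝ)), abs_sub_comm]
    refine lt_of_le_of_lt (Real.sqrt_le_sqrt ?_) (lt_of_le_of_lt (le_max_right _ _) hdet)
    rw [le_div_iff₀ hN]
    have h1 := variance_nullDist_le ht hkt' S (fun x => (f x : ℝ))
    have h2 : N * gammaBar n k l ≤ 1 / 2 := (le_div_iff₀ hγ).1 hN'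
    have h3 : V * (N * gammaBar n k l) ≤ V * (1 / 2) := mul_le_mul_of_nonneg_left h2 hV0
    have h4 : 1 / 2 * V ≤ (1 - (k * t : ℝ) / n) * V :=
      mul_le_mul_of_nonneg_right (by linarith) hV0
    linarith
  have hsum : A.card * Real.sqrt (V * gammaBar n k l) <
      ε * ∑ S ∈ A, ∫ x, (f x : ℝ) * excess S x ∂nullDist n := by
    rw [← nsmul_eq_mul, ← Finset.sum_const, Finset.mul_sum]
    exact Finset.sum_lt_sum_of_nonempty hA0 hlow
  have hsq := sq_sum_integral_mul_excess_le (fun x => (f x : ℝ)) A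
  have hub := sum_sum_integral_excess_le hn hkt' hr l A hcard
  have h5 := pow_lt_pow_left₀ hsum (by positivity) two_ne_zero
  rw [mul_pow, mul_pow, ← sq_abs ε, hε, Real.sq_sqrt (by positivity)] at h5
  have h6 := mul_le_mul_of_nonneg_left hub hV0
  linarith

theorem card_detects_le {n k t : ℕ} (hn : 0 < n) (hk : 0 < k) (ht : 0 < t)
    (hkt : 2 * (k * t) ≤ n)
    (hr : ((k * t : ℕ) : ℝ) ^ 2 / n ≤ 1 / 2) (l : ℕ) {N : ℝ} (hN : 0 < N)
    (hN' : N ≤ 1 / 2 / gammaBar n k l) (f : Query (Fin n → Bool))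
    (A : Finset (Planting n k t)) (hA : ∀ S ∈ A, Detects N f S) :
    (A.card : ℝ) ≤
      2 * (Fintype.card (Planting n k t) *
        ((((k * t : ℕ) : ℝ) ^ 2 / n) ^ l / l.factorial)) := by
  classical
  have key : ∀ ε : ℝ, |ε| = 1 → ∀ B : Finset (Planting n k t),
      (∀ S ∈ B, Detects N f S ∧ 0 ≤ ε * ∫ x, (f x : ℝ) * excess S x ∂nullDist n) →
      (B.card : ℝ) ≤
        Fintype.card (Planting n k t) * ((((k * t : ℕ) : ℝ) ^ 2 / n) ^ l / l.factorial) := by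
    intro ε hε B hB
    rcases B.eq_empty_or_nonempty with rfl | hne
    · rw [Finset.card_empty, Nat.cast_zero]; positivity
    · exact (card_lt_of_detects hn hk ht hkt hr l hN hN' f ε hε B hne hB).le
  rw [← Finset.card_filter_add_card_filter_not
    (fun S => 0 ≤ ∫ x, (f x : ℝ) * excess S x ∂nullDist n), Nat.cast_add, two_mul]
  refine add_le_add (key 1 (by simp) _ fun S hS => ?_) (key (-1) (by simp) _ fun S hS => ?_)
  · rw [Finset.mem_filter] at hS
    exact ⟨hA S hS.1, by rw [one_mul]; exact hS.2⟩
  · rw [Finset.mem_filter] at hS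
    exact ⟨hA S hS.1, by linarith [not_le.1 hS.2]⟩

/-- The queries the algorithm makes when they are answered by `O`. -/
def SQTree.queries {X : Type} (O : Oracle X) : SQTree X → List (Query X)
  | .halt _ => []
  | .ask f next => f :: (next (O f)).queries O

theorem SQTree.length_queries {X : Type} (O : Oracle X) (T : SQTree X) :
    (T.queries O).length = T.numQueries O := by
  induction T with
  | halt b => rfl
  | ask f next ih => simp [SQTree.queries, SQTree.numQueries, ih]

theorem SQTree.output_congr {X : Type} {O O' : Oracle X} (T : SQTree X)
    (h : ∀ f ∈ T.queries O, O' f = O f) : T.output O' = T.output O := by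
  induction T with
  | halt b => rfl
  | ask f next ih =>
    simp only [SQTree.queries, List.mem_cons, forall_eq_or_imp] at h
    rw [SQTree.output, SQTree.output, h.1]
    exact ih _ h.2

/-- The oracle that answers every query by its expectation. -/
noncomputable def exactOracle {X : Type} [MeasurableSpace X] (D : Measure X) : Oracle X :=
  fun f => ∫ x, (f x : ℝ) ∂D

theorem isVSTAT_exactOracle {X : Type} [MeasurableSpace X] (D : Measure X) {N : ℝ} (hN : 0 < N) :
    IsVSTAT D N (exactOracle D) := fun f => by
  rw [exactOracle, sub_self, abs_zero]
  exact le_max_of_le_left (by positivity)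

open Classical in
/-- The oracle for `plantedDist S` that answers as for the null distribution where it may. -/
noncomputable def hidingOracle {n k t : ℕ} (N : ℝ) (S : Planting n k t) :
    Oracle (Fin n → Bool) :=
  fun f => if Detects N f S then exactOracle (plantedDist S) f else exactOracle (nullDist n) f

theorem isVSTAT_hidingOracle {n k t : ℕ} {N : ℝ} (hN : 0 < N) (S : Planting n k t) :
    IsVSTAT (plantedDist S) N (hidingOracle N S) := fun f => by
  by_cases h : Detects N f S
  · rw [hidingOracle, if_pos h]
    exact isVSTAT_exactOracle (plantedDist S) hN f
  · rw [hidingOracle, if_neg h]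
    exact not_lt.1 h

theorem card_exists_detects_le {n k t : ℕ} {N b : ℝ}
    (hb : ∀ (f : Query (Fin n → Bool)) (A : Finset (Planting n k t)),
      (∀ S ∈ A, Detects N f S) → (A.card : ℝ) ≤ b) (L : List (Query (Fin n → Bool)))
    (A : Finset (Planting n k t)) (hA : ∀ S ∈ A, ∃ f ∈ L, Detects N f S) :
    (A.card : ℝ) ≤ L.length * b := by
  classical
  induction L generalizing A with
  | nil =>
    have : A = ∅ := Finset.eq_empty_of_forall_notMem fun S hS => by simpa using hA S hS
    simp [this]
  | cons f L ih =>
    rw [← Finset.card_filter_add_card_filter_not (fun S => Detects N f S), Nat.cast_add,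
      List.length_cons, Nat.cast_add_one, add_mul, one_mul, add_comm]
    refine add_le_add (ih _ fun S hS => ?_) (hb f _ fun S hS => (Finset.mem_filter.1 hS).2)
    rw [Finset.mem_filter] at hS
    obtain ⟨g, hg, hgS⟩ := hA S hS.1
    rcases List.mem_cons.1 hg with rfl | hg
    · exact absurd hgS hS.2
    · exact ⟨g, hg, hgS⟩

/-- If every point of a probability space lies in at most `b` of the events of a finite family,
each of probability at least `a`, then `a` times the number of events is at most `b`. -/
theorem card_mul_le_of_forall_card_le {Ω ι : Type*} [MeasurableSpace Ω] (μ : Measure Ω)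
    [IsProbabilityMeasure μ] [Fintype ι] (E : ι → Set Ω) (hE : ∀ i, MeasurableSet (E i))
    {a b : ℝ} (ha : ∀ i, a ≤ μ.real (E i))
    (hb : ∀ ω, ∀ A : Finset ι, (∀ i ∈ A, ω ∈ E i) → (A.card : ℝ) ≤ b) :
    Fintype.card ι * a ≤ b := by
  classical
  have hint : ∀ i, Integrable ((E i).indicator (1 : Ω → ℝ)) μ := fun i =>
    (integrable_const (1 : ℝ)).indicator (hE i)
  calc Fintype.card ι * a = ∑ _i : ι, a := by simp
    _ ≤ ∑ i, μ.real (E i) := Finset.sum_le_sum fun i _ => ha i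
    _ = ∑ i, ∫ ω, (E i).indicator 1 ω ∂μ := by simp_rw [integral_indicator_one (hE _)]
    _ = ∫ ω, ∑ i, (E i).indicator (1 : Ω → ℝ) ω ∂μ := (integral_finsetSum _ fun i _ => hint i).symm
    _ ≤ ∫ _ω, b ∂μ := by
        refine integral_mono (integrable_finsetSum _ fun i _ => hint i) (integrable_const b)
          fun ω => ?_
        simp only [Set.indicator_apply, Pi.one_apply, Finset.sum_boole]
        exact hb ω _ fun i hi => (Finset.mem_filter.1 hi).2
    _ = b := by simp

theorem RandSQAlg.one_third_le_prob_ne {X : Type} (A : RandSQAlg.{u} X) {O O' : Oracle X}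
    (h : 2 / 3 ≤ A.prob O false) (h' : 2 / 3 ≤ A.prob O' true) :
    let _ := A.mSeed
    MeasurableSet {ω | (A.tree ω).output O ≠ (A.tree ω).output O'} ∧
      1 / 3 ≤ A.law.real {ω | (A.tree ω).output O ≠ (A.tree ω).output O'} := by
  let _ := A.mSeed
  have _ := A.isProb
  have hm := A.measurableSet_output O
  have hm' := A.measurableSet_output O'
  have hset : {ω | (A.tree ω).output O ≠ (A.tree ω).output O'} =
      symmDiff {ω | (A.tree ω).output O = true} {ω | (A.tree ω).output O' = true} := by
    ext ω
    simp only [Set.mem_symmDiff, Set.mem_ofPred_eq]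
    cases (A.tree ω).output O <;> cases (A.tree ω).output O' <;> simp
  have hmeas : MeasurableSet {ω | (A.tree ω).output O ≠ (A.tree ω).output O'} := by
    rw [hset]; exact hm.symmDiff hm'
  refine ⟨hmeas, ?_⟩
  have hfalse : {ω | (A.tree ω).output O = false} = {ω | (A.tree ω).output O = true}ᶜ := by
    ext ω; simp
  have h1 : A.law.real {ω | (A.tree ω).output O = true} ≤ 1 / 3 := by
    change 2 / 3 ≤ A.law.real {ω | (A.tree ω).output O = false} at h
    rw [hfalse, probReal_compl_eq_one_sub hm] at h
    linarith
  have h2 : 2 / 3 ≤ A.law.real {ω | (A.tree ω).output O' = true} := h'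
  have h3 : A.law.real {ω | (A.tree ω).output O' = true} ≤
      A.law.real {ω | (A.tree ω).output O = true} +
        A.law.real {ω | (A.tree ω).output O ≠ (A.tree ω).output O'} := by
    refine (measureReal_mono ?_).trans (measureReal_union_le _ _)
    intro ω hω
    simp only [Set.mem_union, Set.mem_ofPred_eq] at hω ⊢
    rw [hω]
    cases (A.tree ω).output O <;> simp
  linarith

instance nonempty_planting {n k t : ℕ} [Fact (k * t ≤ n)] : Nonempty (Planting n k t) := by
  have h : Fintype.card (Fin t × Fin k) ≤ Fintype.card (Fin n) := by
    simpa [mul_comm] using (Fact.out : k * t ≤ n)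
  obtain ⟨e⟩ := Function.Embedding.nonempty_of_card_le h
  refine ⟨⟨fun i => Finset.univ.map ⟨fun j => e (i, j), fun a b hab => by simpa using hab⟩,
    fun i => by simp, fun i j hij => ?_⟩⟩
  rw [Finset.disjoint_left]
  intro x hx hx'
  simp only [Finset.mem_map, Finset.mem_univ, true_and] at hx hx'
  obtain ⟨a, rfl⟩ := hx
  obtain ⟨b, hb⟩ := hx'
  exact hij (congrArg Prod.fst (e.injective hb)).symm

theorem dimBound_le_of_distinguishes {n k t : ℕ} (hn : 0 < n) (hk : 0 < k) (ht : 0 < t)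
    (hr : ((k * t : ℕ) : ℝ) ^ 2 / n ≤ 1 / 2) (l : ℕ) {N : ℝ} (hN : 0 < N)
    (hN' : N ≤ 1 / 2 / gammaBar n k l) (A : RandSQAlg.{u} (Fin n → Bool)) (q : ℕ)
    (hq : MakesAtMost n k t N A q) (hA : Distinguishes n k t N A) :
    1 / 6 * (dimBound n k t l : ℝ) ≤ q := by
  have hn' : (0 : ℝ) < n := by exact_mod_cast hn
  have hm : (0 : ℝ) < (k * t : ℕ) := by exact_mod_cast Nat.mul_pos hk ht
  have hkt : 2 * (k * t) ≤ n := by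
    rw [div_le_div_iff₀ hn' two_pos, one_mul] at hr
    have h1 : (k * t) ^ 2 * 2 ≤ n := by exact_mod_cast hr
    nlinarith [Nat.mul_pos hk ht]
  have _ : Fact (k * t ≤ n) := ⟨by omega⟩
  let _ := A.mSeed
  have _ := A.isProb
  set ρ := (((k * t : ℕ) : ℝ) ^ 2 / n) ^ l / l.factorial with hρ
  have hρ0 : 0 < ρ := by positivity
  set M := (Fintype.card (Planting n k t) : ℝ) with hM
  have hM0 : 0 < M := by rw [hM]; exact_mod_cast Fintype.card_pos
  have h0 := isVSTAT_exactOracle (nullDist n) hN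
  have hmain : M * (1 / 3) ≤ q * (2 * (M * ρ)) := by
    refine card_mul_le_of_forall_card_le A.law
      (fun S : Planting n k t => {ω | (A.tree ω).output (exactOracle (nullDist n)) ≠
        (A.tree ω).output (hidingOracle N S)})
      (fun S => (A.one_third_le_prob_ne (hA.1 _ h0) (hA.2 S _ (isVSTAT_hidingOracle hN S))).1)
      (fun S => (A.one_third_le_prob_ne (hA.1 _ h0) (hA.2 S _ (isVSTAT_hidingOracle hN S))).2)
      fun ω B hB => ?_
    have hlen : ((A.tree ω).queries (exactOracle (nullDist n))).length ≤ q := by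
      rw [SQTree.length_queries]; exact hq.1 _ h0 ω
    refine (card_exists_detects_le (card_detects_le hn hk ht hkt hr l hN hN')
      ((A.tree ω).queries (exactOracle (nullDist n))) B fun S hS => ?_).trans
      (mul_le_mul_of_nonneg_right (by exact_mod_cast hlen) (by positivity))
    by_contra! hno
    exact hB S hS ((A.tree ω).output_congr fun f hf => if_neg (hno f hf)).symm
  have hd : (dimBound n k t l : ℝ) ≤ ρ⁻¹ := by
    refine (Nat.floor_le (by positivity)).trans (le_of_eq ?_)
    rw [hρ, inv_div, div_eq_mul_inv (l.factorial : ℝ), ← inv_pow, inv_div]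
    push_cast
    rw [mul_pow]
  have h2 : 1 / 6 ≤ q * ρ := by nlinarith
  have h3 : 1 / 6 * ρ⁻¹ ≤ q := by
    rw [← div_eq_mul_inv, div_le_iff₀ hρ0]; exact h2
  linarith

theorem OverlapParam.eventually_ratio_le {k t l : ℕ → ℕ} (h : OverlapParam k t l) :
    ∀ᶠ n : ℕ in atTop, 0 < n ∧ ((k n * t n : ℕ) : ℝ) ^ 2 / n ≤ 1 / 2 := by
  filter_upwards [h.le_min, eventually_gt_atTop 0] with n hn hn0
  refine ⟨hn0, ?_⟩
  have h1 : (1 : ℤ) ≤ ⌊Real.logb 2 ((n : ℝ) / ((k n : ℝ) ^ 2 * (t n : ℝ) ^ 2))⌋ := by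
    have := (le_min_iff.1 hn).2
    have := Int.natCast_nonneg (l n)
    omega
  have h2 := Int.le_floor.1 h1
  have hn' : (0 : ℝ) < n := by exact_mod_cast hn0
  rcases (Nat.zero_le (k n * t n)).eq_or_lt with h0 | h0
  · rw [← h0]; norm_num
  have hm : (0 : ℝ) < ((k n * t n : ℕ) : ℝ) := by exact_mod_cast h0
  rw [← mul_pow, ← Nat.cast_mul] at h2
  rw [Int.cast_one, Real.le_logb_iff_rpow_le one_lt_two (by positivity), Real.rpow_one,
    le_div_iff₀ (by positivity)] at h2
  rw [div_le_iff₀ hn']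
  linarith

section LogOverlap

variable {δ : ℝ} {k t l : ℕ → ℕ}

theorem Regime.exists_rpow_le_ratio (h : Regime δ k t) :
    ∃ K > (0 : ℝ), ∀ᶠ n : ℕ in atTop,
      K * (n : ℝ) ^ (2 * δ) ≤ (n : ℝ) / ((k n : ℝ) ^ 2 * (t n : ℝ) ^ 2) := by
  obtain ⟨M, hM0, hM⟩ := h.isBigO.exists_pos
  refine ⟨(M ^ 2)⁻¹, by positivity, ?_⟩
  filter_upwards [hM.bound, h.pos, eventually_gt_atTop 0] with n hn hpos hn0
  obtain ⟨hk, ht⟩ := hpos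
  have hn' : (0 : ℝ) < n := by exact_mod_cast hn0
  have hk' : (0 : ℝ) < k n := by exact_mod_cast hk
  have ht' : (0 : ℝ) < t n := by exact_mod_cast ht
  rw [Real.norm_of_nonneg (by positivity), Real.norm_of_nonneg (by positivity)] at hn
  have h2 : (k n * t n : ℝ) ^ 2 ≤ (M * (n : ℝ) ^ (1 / 2 - δ)) ^ 2 := by gcongr
  have h3 : ((n : ℝ) ^ (1 / 2 - δ)) ^ 2 * (n : ℝ) ^ (2 * δ) = n := by
    rw [← Real.rpow_natCast, ← Real.rpow_mul hn'.le, ← Real.rpow_add hn']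
    norm_num
    rw [show (1 / 2 - δ) * 2 + 2 * δ = 1 by ring, Real.rpow_one]
  rw [← mul_pow, le_div_iff₀ (by positivity), inv_mul_eq_div, div_mul_eq_mul_div,
    div_le_iff₀ (by positivity)]
  have h4 : (0 : ℝ) ≤ (n : ℝ) ^ (2 * δ) := by positivity
  nlinarith [mul_le_mul_of_nonneg_left h2 h4]

theorem tendsto_log_natCast : Tendsto (fun n : ℕ => Real.log n) atTop atTop :=
  Real.tendsto_log_atTop.comp tendsto_natCast_atTop_atTop

theorem natFloor_logb_bounds (hδ : 0 < δ) {n : ℕ} (hn : 1 ≤ n) :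
    (⌊δ * Real.logb 2 n⌋₊ : ℝ) ≤ δ * Real.log n / Real.log 2 ∧
      δ * Real.log n / Real.log 2 - 1 < ⌊δ * Real.logb 2 n⌋₊ := by
  have hn' : (1 : ℝ) ≤ n := by exact_mod_cast hn
  have h : 0 ≤ δ * Real.logb 2 n := mul_nonneg hδ.le (Real.logb_nonneg one_lt_two hn')
  have e : δ * Real.logb 2 n = δ * Real.log n / Real.log 2 := by
    rw [← Real.log_div_log, mul_div_assoc]
  exact ⟨e ▸ Nat.floor_le h, e ▸ Nat.sub_one_lt_floor _⟩

theorem isBigO_natFloor_logb (hδ : 0 < δ) (hl : ∀ n, l n = ⌊δ * Real.logb 2 n⌋₊) :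
    (fun n => (l n : ℝ)) =O[atTop] fun n : ℕ => Real.log n := by
  refine IsBigO.of_bound (δ / Real.log 2) ?_
  filter_upwards [eventually_ge_atTop 1] with n hn
  rw [hl, Real.norm_natCast, Real.norm_of_nonneg (Real.log_natCast_nonneg n), div_mul_eq_mul_div]
  exact (natFloor_logb_bounds hδ hn).1

theorem Regime.overlapParam (hδ : 0 < δ) (h : Regime δ k t)
    (hlog : (fun n : ℕ => Real.log n ^ 2) =o[atTop] (fun n => (k n * t n : ℝ)))
    (hl : ∀ n, l n = ⌊δ * Real.logb 2 n⌋₊) : OverlapParam k t l := by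
  have hO := isBigO_natFloor_logb hδ hl
  have hlog2 : 0 < Real.log 2 := Real.log_pos one_lt_two
  refine ⟨?_, hO, (hO.pow 2).trans_isLittleO hlog⟩
  obtain ⟨K, hK, hKn⟩ := h.exists_rpow_le_ratio
  filter_upwards [hKn, hlog.bound one_pos, eventually_ge_atTop 1,
    tendsto_log_natCast.eventually_ge_atTop (δ / Real.log 2),
    tendsto_log_natCast.eventually_ge_atTop ((2 * Real.log 2 - Real.log K) / δ)]
    with n hr hb hn hL hL'
  have hn' : (0 : ℝ) < n := by exact_mod_cast hn
  have hln := (natFloor_logb_bounds hδ hn).1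
  rw [← hl] at hln
  refine le_min ?_ ?_
  · rw [one_mul, Real.norm_of_nonneg (by positivity), Real.norm_of_nonneg (by positivity)] at hb
    have h1 : δ / Real.log 2 * Real.log n ≤ Real.log n ^ 2 := by
      rw [sq]; exact mul_le_mul_of_nonneg_right hL (Real.log_natCast_nonneg n)
    have h2 : (l n : ℝ) ≤ k n * t n := by
      rw [← div_mul_eq_mul_div] at hln; linarith
    exact_mod_cast h2
  · rw [le_sub_iff_add_le, Int.le_floor]
    push_cast
    rw [div_le_iff₀ hδ] at hL'
    have hpos : 0 < K * (n : ℝ) ^ (2 * δ) := by positivity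
    have h3 : Real.log K + 2 * δ * Real.log n ≤
        Real.log ((n : ℝ) / ((k n : ℝ) ^ 2 * (t n : ℝ) ^ 2)) := by
      rw [← Real.log_rpow hn', ← Real.log_mul hK.ne' (by positivity)]
      exact Real.log_le_log hpos hr
    rw [← Real.log_div_log, le_div_iff₀ hlog2]
    rw [le_div_iff₀ hlog2] at hln
    nlinarith

theorem Regime.exp_le_dimBound (hδ : 0 < δ) (h : Regime δ k t)
    (hl : ∀ n, l n = ⌊δ * Real.logb 2 n⌋₊) :
    ∀ᶠ n : ℕ in atTop,
      Real.exp (δ ^ 2 / (4 * Real.log 2) * Real.log n ^ 2) ≤ dimBound n (k n) (t n) (l n) := by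
  have hlog2 : 0 < Real.log 2 := Real.log_pos one_lt_two
  obtain ⟨K, hK, hKn⟩ := h.exists_rpow_le_ratio
  filter_upwards [hKn, eventually_ge_atTop 1, tendsto_log_natCast.eventually_ge_atTop 1,
    tendsto_log_natCast.eventually_ge_atTop (2 * Real.log 2 / δ),
    tendsto_log_natCast.eventually_ge_atTop (4 * Real.log 2 * Real.log 2 / δ ^ 2),
    tendsto_log_natCast.eventually_ge_atTop (-Real.log K / δ)] with n hr hn hL0 hL1 hL2 hL3
  have hn' : (0 : ℝ) < n := by exact_mod_cast hn
  set L := Real.log n with hLdef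
  set y := Real.exp (δ ^ 2 / (4 * Real.log 2) * L ^ 2) with hy
  rw [div_le_iff₀ hδ] at hL1 hL3
  rw [div_le_iff₀ (by positivity)] at hL2
  have hl1 : δ * L / (2 * Real.log 2) ≤ l n := by
    have h1 := (natFloor_logb_bounds hδ hn).2.le
    rw [← hl] at h1
    refine le_trans ?_ h1
    rw [le_sub_iff_add_le, div_add_one (by positivity), div_le_div_iff₀ (by positivity) hlog2]
    nlinarith
  have hbase : Real.exp (δ * L) ≤ (n : ℝ) / ((k n : ℝ) ^ 2 * (t n : ℝ) ^ 2) := by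
    refine le_trans ?_ hr
    rw [Real.rpow_def_of_pos hn', ← Real.exp_log hK, ← Real.exp_add]
    refine Real.exp_le_exp.2 ?_
    rw [← hLdef]
    linarith
  have hy2 : 2 ≤ y := by
    rw [← Real.exp_log two_pos, hy]
    refine Real.exp_le_exp.2 ?_
    rw [div_mul_eq_mul_div, le_div_iff₀ (by positivity)]
    nlinarith [mul_pos hlog2 hlog2, sq_nonneg δ, sq_nonneg (δ * L)]
  have hpow : y ^ 2 ≤ (l n).factorial *
      ((n : ℝ) / ((k n : ℝ) ^ 2 * (t n : ℝ) ^ 2)) ^ l n := by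
    calc y ^ 2 = Real.exp (δ * L / (2 * Real.log 2) * (δ * L)) := by
          rw [hy, ← Real.exp_nat_mul]; congr 1; push_cast; field_simp; norm_num
      _ ≤ Real.exp (l n * (δ * L)) := by gcongr
      _ = 1 * Real.exp (δ * L) ^ l n := by rw [Real.exp_nat_mul, one_mul]
      _ ≤ _ := by
          gcongr
          exact_mod_cast Nat.factorial_pos _
  have hfl := Nat.sub_one_lt_floor
    ((l n).factorial * ((n : ℝ) / ((k n : ℝ) ^ 2 * (t n : ℝ) ^ 2)) ^ l n)
  change _ < (dimBound n (k n) (t n) (l n) : ℝ) at hfl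
  nlinarith

theorem isTheta_div_gammaBar (hδ : 0 < δ) (hl : ∀ n, l n = ⌊δ * Real.logb 2 n⌋₊) {C : ℝ}
    (hC : 0 < C) :
    (fun n : ℕ => C / gammaBar n (k n) (l n)) =Θ[atTop]
      (fun n : ℕ => (n : ℝ) ^ (2 - δ) / (k n : ℝ) ^ 2) := by
  have hlog2 : 0 < Real.log 2 := Real.log_pos one_lt_two
  have key : ∀ᶠ n : ℕ in atTop, (n : ℝ) ^ (2 - δ) / (k n : ℝ) ^ 2 * (C / 2) ≤
      C / gammaBar n (k n) (l n) ∧ C / gammaBar n (k n) (l n) ≤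
        (n : ℝ) ^ (2 - δ) / (k n : ℝ) ^ 2 * C := by
    filter_upwards [eventually_ge_atTop 1] with n hn
    have hn' : (0 : ℝ) < n := by exact_mod_cast hn
    have e : ∀ x : ℝ, (2 : ℝ) ^ x = Real.exp (Real.log 2 * x) :=
      fun x => Real.rpow_def_of_pos two_pos x
    obtain ⟨h1, h2⟩ := natFloor_logb_bounds hδ hn
    rw [← hl] at h1 h2
    have hup : (2 : ℝ) ^ l n ≤ (n : ℝ) ^ δ := by
      rw [← Real.rpow_natCast, e, Real.rpow_def_of_pos hn']
      rw [le_div_iff₀ hlog2] at h1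
      exact Real.exp_le_exp.2 (by linarith)
    have hlo : (n : ℝ) ^ δ ≤ 2 * 2 ^ l n := by
      rw [← pow_succ', ← Real.rpow_natCast, e, Real.rpow_def_of_pos hn']
      rw [sub_lt_iff_lt_add, div_lt_iff₀ hlog2] at h2
      push_cast
      exact Real.exp_le_exp.2 (by linarith)
    have hnδ : (n : ℝ) ^ (2 - δ) = n ^ 2 / (n : ℝ) ^ δ := by
      rw [Real.rpow_sub hn', Real.rpow_ofNat]
    have hnp : (0 : ℝ) < (n : ℝ) ^ δ := by positivity
    have hg : C / gammaBar n (k n) (l n) = n ^ 2 / (k n : ℝ) ^ 2 * C / (2 * 2 ^ l n) := by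
      rcases eq_or_ne (k n) 0 with h0 | h0
      · simp [gammaBar, h0]
      · have : (k n : ℝ) ≠ 0 := by exact_mod_cast h0
        rw [gammaBar]; field_simp
    have hg' : ∀ c : ℝ, (n : ℝ) ^ (2 - δ) / (k n : ℝ) ^ 2 * c =
        n ^ 2 / (k n : ℝ) ^ 2 * c / (n : ℝ) ^ δ := fun c => by rw [hnδ]; ring
    rw [hg, hg', hg']
    refine ⟨?_, ?_⟩
    · rw [show (n : ℝ) ^ 2 / (k n : ℝ) ^ 2 * (C / 2) / (n : ℝ) ^ δ =
        n ^ 2 / (k n : ℝ) ^ 2 * C / (2 * (n : ℝ) ^ δ) by field_simp]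
      gcongr
    · gcongr
  constructor
  · refine IsBigO.of_bound C ?_
    filter_upwards [key] with n hn
    have h0 : (0 : ℝ) ≤ gammaBar n (k n) (l n) := by unfold gammaBar; positivity
    rw [Real.norm_of_nonneg (by positivity), Real.norm_of_nonneg (by positivity), mul_comm]
    exact hn.2
  · refine IsBigO.of_bound (2 / C) ?_
    filter_upwards [key] with n hn
    have h0 : (0 : ℝ) ≤ gammaBar n (k n) (l n) := by unfold gammaBar; positivity
    rw [Real.norm_of_nonneg (by positivity), Real.norm_of_nonneg (by positivity),
      div_mul_eq_mul_div, le_div_iff₀ hC]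
    linarith [hn.1]

end LogOverlap

end MultiBiclique


theorem theorem3 :
    ∃ c > (0 : ℝ), ∃ C > (0 : ℝ),
      (∀ (δ : ℝ) (k t l : ℕ → ℕ), 0 < δ → MultiBiclique.Regime δ k t →
        MultiBiclique.OverlapParam k t l →
        ∀ᶠ n : ℕ in atTop, ∀ N : ℝ, 0 < N → N ≤ C / MultiBiclique.gammaBar n (k n) (l n) →
          ∀ (A : MultiBiclique.RandSQAlg.{u} (Fin n → Bool)) (q : ℕ),
            MultiBiclique.MakesAtMost n (k n) (t n) N A q →
            MultiBiclique.Distinguishes n (k n) (t n) N A →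
            c * (MultiBiclique.dimBound n (k n) (t n) (l n) : ℝ) ≤ q) ∧
      (∀ δ : ℝ, 0 < δ → ∃ a > (0 : ℝ), ∀ k t l : ℕ → ℕ, MultiBiclique.Regime δ k t →
        (fun n : ℕ => Real.log n ^ 2) =o[atTop] (fun n => (k n * t n : ℝ)) →
        (∀ n, l n = ⌊δ * Real.logb 2 n⌋₊) →
        MultiBiclique.OverlapParam k t l ∧
        (∀ᶠ n : ℕ in atTop,
          Real.exp (a * Real.log n ^ 2) ≤ MultiBiclique.dimBound n (k n) (t n) (l n)) ∧
        (fun n : ℕ => C / MultiBiclique.gammaBar n (k n) (l n)) =Θ[atTop]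
          (fun n : ℕ => (n : ℝ) ^ (2 - δ) / (k n : ℝ) ^ 2)) := by
  refine ⟨1 / 6, by norm_num, 1 / 2, by norm_num, ?_, ?_⟩
  · intro δ k t l _ hreg hov
    filter_upwards [hreg.pos, hov.eventually_ratio_le] with n hpos hr N hN hN' A q hq hA
    exact MultiBiclique.dimBound_le_of_distinguishes hr.1 hpos.1 hpos.2 hr.2 (l n) hN hN' A q hq hA
  · intro δ hδ
    have hlog2 : 0 < Real.log 2 := Real.log_pos one_lt_two
    refine ⟨δ ^ 2 / (4 * Real.log 2), by positivity, fun k t l hreg hlog hl => ?_⟩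
    exact ⟨hreg.overlapParam hδ hlog hl, hreg.exp_le_dimBound hδ hl,
      MultiBiclique.isTheta_div_gammaBar hδ hl (by norm_num)⟩
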